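/- Let $0<\alpha_0<\beta_0<1$ and $\gamma>0$ be fixed. For $N=2^M$, $M=0,1,2,\dots$, let $S^0_N=[\lfloor\alpha_0N\rfloor,\lfloor\beta_0N\rfloor)$ and let $X_0,\dots,X_{N-1}$ (depending on $N$) be independent exponential random variables with $\mathbb E[X_n]=1+\gamma$ if $n\in S^0_N$ and $\mathbb E[X_n]=1$ otherwise; all these variables, for all $N$, are defined on one probability space, with an arbitrary joint law for different $N$. For an interval $S=[a,b)\subseteq[0,N)$ of integers with $a<b$, let $\overline X_S=\frac1{|S|}\sum_{n\in S}X_n$, $\overline X_S^+=\max\{\overline X_S,1\}$ and $J(S)=|S|\,[\overline X_S^+-1-\log \overline X_S^+]$. The binary interval estimation algorithm computes intervals $\widehat S^{(t)}_N=[\widehat a^{(t)}_N,\widehat b^{(t)}_N)$, $t=0,\dots,M$, as follows. Start with $\widehat S^{(0)}_N=[0,N)$. Given $[\widehat a,\widehat b)=\widehat S^{(t)}_N$ with $t<M$, put $\ell=2^{M-t-1}$. First update the left boundary: among the admissible candidates $\widehat a,\ \widehat a-\ell,\ \widehat a+\ell$ (a candidate $a'$ is admissible if $0\le a'<\widehat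 b$), taken in this order, let $\widehat a^{(t+1)}_N$ be the first one that maximizes $J([a',\widehat b))$. Then update the right boundary: among the admissible candidates $\widehat b,\ \widehat b-\ell,\ \widehat b+\ell$ (a candidate $b'$ is admissible if $\widehat a^{(t+1)}_N<b'\le N$), taken in this order, let $\widehat b^{(t+1)}_N$ be the first one that maximizes $J([\widehat a^{(t+1)}_N,b'))$. (The averages $\overline X_S$ are not recomputed but updated from the precomputed averages of $X$ over the dyadic intervals $[i2^m,(i+1)2^m)$.) After the $M$ iterations the estimate no longer changes: $\widehat S^{(t)}_N=\widehat S^{(M)}_N$ for $t>M$. Then the intersection over union $$\mathrm{IoU}^{(t)}_N=\frac{|\widehat S^{(t)}_N\cap S^0_N|}{|\widehat S^{(t)}_N\cup S^0_N|}$$ satisfies, almost surely, $\lim_{N,t\to\infty}\mathrm{IoU}^{(t)}_N=1$, as a joint limit in which $N\to\infty$ through the powers of two and $t\to\infty$. -/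

import Mathlib

/-! ### The statistical model -/

/-- The true signal interval `[⌊α₀ N⌋, ⌊β₀ N⌋)` among the bins `0, …, N - 1`, with `N = 2 ^ M`. -/
noncomputable def trueInterval (α₀ β₀ : ℝ) (M : ℕ) : Finset ℤ :=
  Finset.Ico ⌊α₀ * (2 : ℝ) ^ M⌋ ⌊β₀ * (2 : ℝ) ^ M⌋

/-- The expected power of bin `n`: `1 + γ` in the signal interval `S`, and `1` outside. -/
noncomputable def meanPower (γ : ℝ) (S : Finset ℤ) (n : ℕ) : ℝ :=
  if (n : ℤ) ∈ S then 1 + γ else 1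

/-! ### The binary interval estimation algorithm -/

/-- The dyadic powers `Z_{m,i}`, i.e. the averages of `X` over `[i 2 ^ m, (i + 1) 2 ^ m)`,
computed by repeatedly merging adjacent intervals. -/
noncomputable def dyadicPower (X : ℕ → ℝ) : ℕ → ℕ → ℝ
  | 0, i => X i
  | m + 1, i => (dyadicPower X m (2 * i) + dyadicPower X m (2 * i + 1)) / 2

/-- The likelihood of an interval of length `L` and average power `Z`,
maximized over the SNR: `L (Z⁺ - 1 - log Z⁺)` with `Z⁺ = max {Z, 1}`. -/
noncomputable def objective (L Z : ℝ) : ℝ :=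
  L * (max Z 1 - 1 - Real.log (max Z 1))

/-- The variables of the search: the left and right indices of the current interval (in units of
the current sub-interval length), its average power, its length, and the best objective so far. -/
structure SearchState where
  left : ℤ
  right : ℤ
  avg : ℝ
  len : ℝ
  best : ℝ

/-- The initial state: the whole interval `[0, 2 ^ M)`, as one sub-interval of length `2 ^ M`. -/
noncomputable def initState (X : ℕ → ℝ) (M : ℕ) : SearchState where
  left := 0
  right := 1
  avg := dyadicPower X M 0
  len := (2 : ℝ) ^ M
  best := objective ((2 : ℝ) ^ M) (dyadicPower X M 0)

/-- Try to move the left boundary of `base` by `δ = ± 1` sub-intervals of length `2 ^ m`; the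
incumbent `cur` is replaced if the objective increases strictly and the new interval is admissible.
The sub-interval that is added or removed is the one with index `min {left, left + δ}`. -/
noncomputable def tryLeft (X : ℕ → ℝ) (m : ℕ) (base cur : SearchState) (δ : ℤ) : SearchState :=
  let i' : ℤ := base.left + δ
  let L' : ℝ := base.len - δ * (2 : ℝ) ^ m
  let Z' : ℝ := (base.len * base.avg
    - δ * (2 : ℝ) ^ m * dyadicPower X m (min base.left i').toNat) / L'
  let J' : ℝ := objective L' Z'
  open Classical in
  if cur.best < J' ∧ 0 < L' ∧ 0 ≤ i' then
    { cur with left := i', avg := Z', len := L', best := J' }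
  else cur

/-- Try to move the right boundary of `base` by `δ = ± 1` sub-intervals of length `2 ^ m`, where
`bound` is the number of sub-intervals of `[0, N)`.
The sub-interval that is added or removed is the one with index `min {right, right + δ}`. -/
noncomputable def tryRight (X : ℕ → ℝ) (m : ℕ) (bound : ℤ) (base cur : SearchState) (δ : ℤ) :
    SearchState :=
  let j' : ℤ := base.right + δ
  let L' : ℝ := base.len + δ * (2 : ℝ) ^ m
  let Z' : ℝ := (base.len * base.avg
    + δ * (2 : ℝ) ^ m * dyadicPower X m (min base.right j').toNat) / L'
  let J' : ℝ := objective L' Z'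
  open Classical in
  if cur.best < J' ∧ 0 < L' ∧ j' ≤ bound then
    { cur with right := j', avg := Z', len := L', best := J' }
  else cur

/-- Iteration `t` of the search (`0 ≤ t < M`): the sub-interval length is halved to
`2 ^ (M - t - 1)`, so that the indices of the boundaries double; then the left boundary is optimized
over `δ = -1, 1` (in this order), and after it the right boundary. -/
noncomputable def searchStep (X : ℕ → ℝ) (M t : ℕ) (s : SearchState) : SearchState :=
  let m : ℕ := M - t - 1
  let s₀ : SearchState := { s with left := 2 * s.left, right := 2 * s.right }
  let s₁ : SearchState := tryLeft X m s₀ (tryLeft X m s₀ s₀ (-1)) 1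
  tryRight X m (2 ^ (t + 1)) s₁ (tryRight X m (2 ^ (t + 1)) s₁ s₁ (-1)) 1

/-- The state of the search on `X 0, …, X (2 ^ M - 1)` after `t` iterations. -/
noncomputable def searchState (X : ℕ → ℝ) (M : ℕ) : ℕ → SearchState
  | 0 => initState X M
  | t + 1 => searchStep X M t (searchState X M t)

/-- The `t`-th estimate `[i ℓ, j ℓ)`, with sub-interval length `ℓ = 2 ^ (M - t)`, for `t ≤ M`.
The search stops after `M` iterations; for `t > M` the estimate is the final one. -/
noncomputable def estimatedInterval (X : ℕ → ℝ) (M t : ℕ) : Finset ℤ :=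
  let s := searchState X M (min t M)
  let ℓ : ℤ := 2 ^ (M - min t M)
  Finset.Ico (s.left * ℓ) (s.right * ℓ)

/-- Intersection over union. -/
noncomputable def IoU (S T : Finset ℤ) : ℝ :=
  ((S ∩ T).card : ℝ) / ((S ∪ T).card : ℝ)

/-! ### The objective as a supremum of linear functionals -/

/-! The probability enters once. Almost surely, for every `δ > 0` and all large `N`, every interval
sum is within `δ N` of its mean (`ae_eventually_abs_intervalSum_sub_le`). The rest is deterministic.

As a function of length `L` and sum `s`, the objective is a supremum of the functionals `s (1 - 1/z)
- L log z` over `z ≥ 1`, attained at `z = s / L` when this is at least `1`. Comparing two intervals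
through the optimal functional of the first shows the following, whenever the first has objective at
least `j N`: cutting off at least `τ N` noise bins at an end, or appending at least `τ N` signal
bins, strictly increases the objective (`objective_lt_of_remove`, `objective_lt_of_add`). The other
end need not be correct; it suffices that the interval meets the signal, which an objective of at
least `j N` forces.

The whole range `[0, N)` already has objective at least `j N`, and the search never lowers it.
Hence, while sub-intervals have at least `τ N` bins, a boundary more than one sub-interval away from
its target would have a strictly better neighbour among the candidates, against optimality
(`IsNearSignal.tracking`). With `τ = 2⁻ᵀ` this controls the first `T` iterations. The later ones may
be driven by noise, but their steps form a geometric series of total at most `2⁻ᵀ N`. So both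
boundaries end within `2 · 2⁻ᵀ N` of the truth, uniformly in `t ≥ T`, and `T` is arbitrary. -/

theorem mul_sub_mul_log_le_objective {L z : ℝ} (s : ℝ) (hL : 0 < L) (hz : 1 ≤ z) :
    s * (1 - z⁻¹) - L * Real.log z ≤ objective L (s / L) := by
  have hz0 : 0 < z := by linarith
  set w := max (s / L) 1 with hw
  have hw1 : 1 ≤ w := le_max_right _ _
  have hsw : s ≤ L * w := by
    have : s / L ≤ w := le_max_left _ _
    rwa [div_le_iff₀' hL] at this
  have hz1 : 0 ≤ 1 - z⁻¹ := by
    have := inv_le_one_of_one_le₀ hz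
    linarith
  have h1 := mul_le_mul_of_nonneg_right hsw hz1
  -- The tangent at `z` to the convex function `w - 1 - log w`.
  have h2 := Real.log_le_sub_one_of_pos (show 0 < w / z by positivity)
  rw [Real.log_div (by linarith) hz0.ne', div_eq_mul_inv] at h2
  have h3 : L * (w * (1 - z⁻¹) - Real.log z) ≤ L * (w - 1 - Real.log w) :=
    mul_le_mul_of_nonneg_left (by linarith) hL.le
  unfold objective
  linarith

theorem objective_of_one_le {L Z : ℝ} (hZ : 1 ≤ Z) : objective L Z = L * (Z - 1 - Real.log Z) := by
  rw [objective, max_eq_left hZ]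

theorem one_lt_of_objective_pos {L Z : ℝ} (h : 0 < objective L Z) : 1 < Z := by
  by_contra hZ
  rw [objective, max_eq_right (not_lt.1 hZ)] at h
  simp at h

/-- Since `log Z ≥ 0` for `Z ≥ 1`, a large objective forces a large excess of the sum over the
length. -/
theorem objective_le_max {L s : ℝ} (hL : 0 < L) : objective L (s / L) ≤ max (s - L) 0 := by
  by_cases h : 0 < objective L (s / L)
  · have h1 := one_lt_of_objective_pos h
    rw [objective_of_one_le h1.le]
    have := Real.log_nonneg h1.le
    refine le_trans ?_ (le_max_left _ _)
    have h2 : L * (s / L) = s := mul_div_cancel₀ s hL.ne'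
    nlinarith
  · exact le_trans (not_lt.1 h) (le_max_right _ _)

/-- Removing from an interval a part whose average is close to `1` increases the objective. -/
theorem objective_lt_of_remove {N L l s d j δ τ : ℝ} (hj : 0 < j) (hN : 0 < N) (hl : 0 < l)
    (hlL : l < L) (hLN : L ≤ N) (hJ : j * N ≤ objective L (s / L)) (hd : d ≤ l + δ * N)
    (hτ : τ * N ≤ l) (hδ0 : 0 ≤ δ) (hδ : δ < τ * (Real.log (1 + j) - 1 + (1 + j)⁻¹)) :
    objective L (s / L) < objective (L - l) ((s - d) / (L - l)) := by
  have hL : 0 < L := hl.trans hlL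
  have hz1 : 1 < s / L := one_lt_of_objective_pos (lt_of_lt_of_le (by positivity) hJ)
  set z := s / L with hz
  have hs : L * z = s := mul_div_cancel₀ s hL.ne'
  have hz0 : 0 < z := by linarith
  -- The functional at `z = s / L` is exact for the old interval, so the gain is at least `l log z -
  -- d (1 - 1/z)`.
  have hvar := mul_sub_mul_log_le_objective (s - d) (sub_pos.2 hlL) hz1.le
  rw [objective_of_one_le hz1.le] at hJ ⊢
  have hzj : 1 + j ≤ z := by
    have h1 := Real.log_nonneg hz1.le
    have h2 : L * (z - 1 - Real.log z) ≤ N * (z - 1) := by nlinarith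
    have h3 : j * N ≤ (z - 1) * N := by linarith
    have := le_of_mul_le_mul_right h3 hN
    linarith
  -- `log z - 1 + 1/z` increases on `z ≥ 1`; it is the gain per noise bin removed, before the error
  -- `δ N`.
  have hmono : Real.log (1 + j) - 1 + (1 + j)⁻¹ ≤ Real.log z - 1 + z⁻¹ := by
    have h1 := Real.one_sub_inv_le_log_of_pos (show 0 < z / (1 + j) by positivity)
    rw [Real.log_div hz0.ne' (by positivity), inv_div] at h1
    have h2 : (1 + j) / z = z⁻¹ + j * z⁻¹ := by field_simp
    have h3 : z⁻¹ ≤ (1 + j)⁻¹ := inv_anti₀ (by linarith) hzj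
    have h4 : j * z⁻¹ ≤ j * (1 + j)⁻¹ := mul_le_mul_of_nonneg_left h3 hj.le
    have h5 : (1 + j)⁻¹ + j * (1 + j)⁻¹ = 1 := by field_simp
    linarith
  have hinv : z * z⁻¹ = 1 := mul_inv_cancel₀ hz0.ne'
  have hinv0 : 0 < z⁻¹ := inv_pos.2 hz0
  have hinv1 : z⁻¹ < 1 := inv_lt_one_of_one_lt₀ hz1
  have hsz : s * (1 - z⁻¹) = L * z - L := by rw [← hs]; linear_combination (-L) * hinv
  have hd' : d * (1 - z⁻¹) ≤ l * (1 - z⁻¹) + δ * N := by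
    have h1 := mul_le_mul_of_nonneg_right hd (show 0 ≤ 1 - z⁻¹ by linarith)
    have : 0 ≤ δ * N := by positivity
    nlinarith
  have hgap : δ * N < l * (Real.log z - 1 + z⁻¹) := by
    have h0 : 0 ≤ Real.log z - 1 + z⁻¹ := by
      have := Real.one_sub_inv_le_log_of_pos hz0
      linarith
    have hτ0 : 0 < τ := by
      have h1 : 0 ≤ Real.log (1 + j) - 1 + (1 + j)⁻¹ := by
        have := Real.one_sub_inv_le_log_of_pos (show 0 < 1 + j by positivity)
        linarith
      by_contra hcon
      nlinarith [mul_nonneg (neg_nonneg.2 (not_lt.1 hcon)) h1]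
    calc δ * N < τ * (Real.log (1 + j) - 1 + (1 + j)⁻¹) * N := by gcongr
      _ ≤ τ * (Real.log z - 1 + z⁻¹) * N := by gcongr
      _ = (τ * N) * (Real.log z - 1 + z⁻¹) := by ring
      _ ≤ _ := by gcongr
  linarith

/-- Adding to an interval a part whose average is close to the maximal one `1 + γ` increases the
objective. -/
theorem objective_lt_of_add {N L l s d j δ τ γ : ℝ} (hj : 0 < j) (hγ : 0 < γ) (hN : 0 < N)
    (hl : 0 < l) (hL : 0 < L) (hLN : L ≤ N) (hJ : j * N ≤ objective L (s / L))
    (hs : s ≤ (1 + γ) * L + δ * N) (hd : (1 + γ) * l - δ * N ≤ d) (hτ : τ * N ≤ l) (hδ0 : 0 ≤ δ)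
    (hδj : 2 * δ ≤ j) (hδγ : 4 * γ * δ ≤ j ^ 2) (hδτ : 2 * δ < τ * j) :
    objective L (s / L) < objective (L + l) ((s + d) / (L + l)) := by
  have hz1 : 1 < s / L := one_lt_of_objective_pos (lt_of_lt_of_le (by positivity) hJ)
  have hmax := objective_le_max (s := s) hL
  set z := s / L with hz
  have hsz : L * z = s := mul_div_cancel₀ s hL.ne'
  have hz0 : 0 < z := by linarith
  have hvar := mul_sub_mul_log_le_objective (s + d) (add_pos hL hl) hz1.le
  rw [max_eq_left (by nlinarith)] at hmax
  have hδN : 0 ≤ δ * N := by positivity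
  -- The excess `s - L` is at most `γ L + j N / 2`, so the interval cannot be short. Then the noise
  -- raises its average above `1 + γ` by at most `j / 2`.
  have hLlow : j * N ≤ 2 * γ * L := by nlinarith
  rw [objective_of_one_le hz1.le] at hJ ⊢
  have hφ : j ≤ z - 1 - Real.log z := by
    have h0 : 0 ≤ z - 1 - Real.log z := by
      have := Real.log_le_sub_one_of_pos hz0
      linarith
    have h3 : j * N ≤ (z - 1 - Real.log z) * N := by nlinarith
    exact le_of_mul_le_mul_right h3 hN
  have hzγ : z ≤ 1 + γ + j / 2 := by
    have h1 : δ * N ≤ j / 2 * L := by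
      have h2 : 4 * γ * (δ * N) ≤ 4 * γ * (j / 2 * L) := by nlinarith
      exact le_of_mul_le_mul_left h2 (by positivity)
    have h2 : L * z ≤ L * (1 + γ + j / 2) := by linarith
    exact le_of_mul_le_mul_left h2 hL
  have hinv : z * z⁻¹ = 1 := mul_inv_cancel₀ hz0.ne'
  have hinv0 : 0 < z⁻¹ := inv_pos.2 hz0
  have hinv1 : z⁻¹ < 1 := inv_lt_one_of_one_lt₀ hz1
  have hsz' : s * (1 - z⁻¹) = L * z - L := by rw [← hsz]; linear_combination (-L) * hinv
  have hd' : (1 + γ) * l * (1 - z⁻¹) - δ * N ≤ d * (1 - z⁻¹) := by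
    have h1 := mul_le_mul_of_nonneg_right hd (show 0 ≤ 1 - z⁻¹ by linarith)
    nlinarith
  -- As `1 + γ ≥ z - j/2`, the gain per added bin is at least `z - 1 - log z - j/2 ≥ j/2`, up to the
  -- error `δ N`.
  have hγz : l * (z - 1 - j / 2) ≤ (1 + γ) * l * (1 - z⁻¹) := by
    have h1 : (z - j / 2) * (1 - z⁻¹) ≤ (1 + γ) * (1 - z⁻¹) :=
      mul_le_mul_of_nonneg_right (by linarith) (by linarith)
    have h2 : z - 1 - j / 2 ≤ (z - j / 2) * (1 - z⁻¹) := by nlinarith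
    nlinarith
  have hgap : δ * N < l * (z - 1 - Real.log z - j / 2) := by
    have h1 : 2 * (δ * N) < j * l := by nlinarith
    nlinarith
  linarith

/-! ### The search evaluates the objective of intervals -/

/-- The sum of `x` over the bins in `[a, b)`. -/
noncomputable def intervalSum (x : ℕ → ℝ) (a b : ℤ) : ℝ :=
  ∑ n ∈ Finset.Ico a.toNat b.toNat, x n

/-- The objective of the interval `[a, b)`. -/
noncomputable def intervalObjective (x : ℕ → ℝ) (a b : ℤ) : ℝ :=
  objective ((b : ℝ) - a) (intervalSum x a b / ((b : ℝ) - a))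

theorem intervalSum_add (x : ℕ → ℝ) {a b c : ℤ} (hab : a ≤ b) (hbc : b ≤ c) :
    intervalSum x a b + intervalSum x b c = intervalSum x a c :=
  Finset.sum_Ico_consecutive x (Int.toNat_le_toNat hab) (Int.toNat_le_toNat hbc)

theorem two_pow_mul_dyadicPower (x : ℕ → ℝ) (m i : ℕ) :
    (2 : ℝ) ^ m * dyadicPower x m i = ∑ n ∈ Finset.Ico (i * 2 ^ m) ((i + 1) * 2 ^ m), x n := by
  induction m generalizing i with
  | zero => simp [dyadicPower]
  | succ m ih =>
    have h : (2 : ℝ) ^ (m + 1) * dyadicPower x (m + 1) i =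
        2 ^ m * dyadicPower x m (2 * i) + 2 ^ m * dyadicPower x m (2 * i + 1) := by
      rw [dyadicPower]; ring
    rw [h, ih, ih, Finset.sum_Ico_consecutive x (by gcongr; omega) (by gcongr; omega)]
    congr 2 <;> ring

theorem two_pow_mul_dyadicPower_toNat (x : ℕ → ℝ) (m : ℕ) {i : ℤ} (hi : 0 ≤ i) :
    (2 : ℝ) ^ m * dyadicPower x m i.toNat = intervalSum x (i * 2 ^ m) ((i + 1) * 2 ^ m) := by
  lift i to ℕ using hi
  rw [Int.toNat_natCast, two_pow_mul_dyadicPower, intervalSum]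
  have h1 : ((i : ℤ) * 2 ^ m).toNat = i * 2 ^ m := by
    rw [show (i : ℤ) * 2 ^ m = ((i * 2 ^ m : ℕ) : ℤ) by push_cast; rfl, Int.toNat_natCast]
  have h2 : (((i : ℤ) + 1) * 2 ^ m).toNat = (i + 1) * 2 ^ m := by
    rw [show ((i : ℤ) + 1) * 2 ^ m = (((i + 1) * 2 ^ m : ℕ) : ℤ) by push_cast; rfl,
      Int.toNat_natCast]
  rw [h1, h2]

/-- The state `s` describes a nonempty interval of `[0, bound)` in units of `2 ^ m`, together with
its length, its average and its objective. -/
structure SearchState.IsConsistent (x : ℕ → ℝ) (m : ℕ) (bound : ℤ) (s : SearchState) : Prop where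
  left_nonneg : 0 ≤ s.left
  left_lt_right : s.left < s.right
  right_le : s.right ≤ bound
  len_eq : s.len = ((s.right : ℝ) - s.left) * 2 ^ m
  len_mul_avg : s.len * s.avg = intervalSum x (s.left * 2 ^ m) (s.right * 2 ^ m)
  best_eq : s.best = intervalObjective x (s.left * 2 ^ m) (s.right * 2 ^ m)

theorem intervalObjective_mul_two_pow (x : ℕ → ℝ) (m : ℕ) (a b : ℤ) :
    intervalObjective x (a * 2 ^ m) (b * 2 ^ m) = objective (((b : ℝ) - a) * 2 ^ m)
      (intervalSum x (a * 2 ^ m) (b * 2 ^ m) / (((b : ℝ) - a) * 2 ^ m)) := by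
  rw [intervalObjective]
  push_cast
  rw [sub_mul]

theorem intervalSum_left_shift (x : ℕ → ℝ) (m : ℕ) {a b δ : ℤ} (hδ : δ = -1 ∨ δ = 1)
    (ha : 0 ≤ a) (hab : a < b) (h0 : 0 ≤ a + δ) (hb : a + δ < b) :
    intervalSum x (a * 2 ^ m) (b * 2 ^ m) -
      δ * (2 : ℝ) ^ m * dyadicPower x m (min a (a + δ)).toNat =
      intervalSum x ((a + δ) * 2 ^ m) (b * 2 ^ m) := by
  rcases hδ with rfl | rfl
  · rw [min_eq_right (by omega)]
    have h1 := two_pow_mul_dyadicPower_toNat x m h0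
    have h2 := intervalSum_add x (a := (a + -1) * 2 ^ m) (b := (a + -1 + 1) * 2 ^ m)
      (c := b * 2 ^ m)
      (mul_le_mul_of_nonneg_right (by omega) (by positivity))
      (mul_le_mul_of_nonneg_right (by omega) (by positivity))
    rw [show a + -1 + 1 = a by ring] at h1 h2
    push_cast
    linarith
  · rw [min_eq_left (by omega)]
    have h1 := two_pow_mul_dyadicPower_toNat x m ha
    have h2 := intervalSum_add x (a := a * 2 ^ m) (b := (a + 1) * 2 ^ m)
      (c := b * 2 ^ m)
      (mul_le_mul_of_nonneg_right (by omega) (by positivity))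
      (mul_le_mul_of_nonneg_right (by omega) (by positivity))
    push_cast
    linarith

theorem intervalSum_right_shift (x : ℕ → ℝ) (m : ℕ) {a b δ : ℤ} (hδ : δ = -1 ∨ δ = 1)
    (ha : 0 ≤ a) (hab : a < b) (hb : a < b + δ) :
    intervalSum x (a * 2 ^ m) (b * 2 ^ m) +
      δ * (2 : ℝ) ^ m * dyadicPower x m (min b (b + δ)).toNat =
      intervalSum x (a * 2 ^ m) ((b + δ) * 2 ^ m) := by
  rcases hδ with rfl | rfl
  · rw [min_eq_right (by omega)]
    have h1 := two_pow_mul_dyadicPower_toNat x m (show 0 ≤ b + -1 by omega)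
    have h2 := intervalSum_add x (a := a * 2 ^ m) (b := (b + -1) * 2 ^ m)
      (c := (b + -1 + 1) * 2 ^ m) (mul_le_mul_of_nonneg_right (by omega) (by positivity))
      (mul_le_mul_of_nonneg_right (by omega) (by positivity))
    rw [show b + -1 + 1 = b by ring] at h1 h2
    push_cast
    linarith
  · rw [min_eq_left (by omega)]
    have h1 := two_pow_mul_dyadicPower_toNat x m (show 0 ≤ b by omega)
    have h2 := intervalSum_add x (a := a * 2 ^ m) (b := b * 2 ^ m)
      (c := (b + 1) * 2 ^ m) (mul_le_mul_of_nonneg_right (by omega) (by positivity))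
      (mul_le_mul_of_nonneg_right (by omega) (by positivity))
    push_cast
    linarith

/-- Both trials start from `base` but compete with `cur`. The test `0 < L'` is the admissibility
condition that the new left end lies below the right one. -/
theorem tryLeft_spec {x : ℕ → ℝ} {m : ℕ} {bound δ : ℤ} {base cur : SearchState}
    (hδ : δ = -1 ∨ δ = 1) (hbase : base.IsConsistent x m bound)
    (hcur : cur.IsConsistent x m bound) (hright : cur.right = base.right) :
    (tryLeft x m base cur δ).IsConsistent x m bound ∧
      (tryLeft x m base cur δ).right = base.right ∧
      ((tryLeft x m base cur δ).left = cur.left ∨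
        (tryLeft x m base cur δ).left = base.left + δ) ∧
      cur.best ≤ (tryLeft x m base cur δ).best ∧
      (0 ≤ base.left + δ → base.left + δ < base.right →
        intervalObjective x ((base.left + δ) * 2 ^ m) (base.right * 2 ^ m) ≤
          (tryLeft x m base cur δ).best) := by
  have hL : base.len - δ * (2 : ℝ) ^ m =
      ((base.right : ℝ) - ((base.left + δ : ℤ) : ℝ)) * 2 ^ m := by
    rw [hbase.len_eq]; push_cast; ring
  have hpos : 0 < base.len - δ * (2 : ℝ) ^ m ↔ base.left + δ < base.right := by
    rw [hL, mul_pos_iff_of_pos_right (by positivity), sub_pos, Int.cast_lt]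
  have hsum (h0 : 0 ≤ base.left + δ) (h1 : base.left + δ < base.right) :
      base.len * base.avg - δ * (2 : ℝ) ^ m *
        dyadicPower x m (min base.left (base.left + δ)).toNat =
        intervalSum x ((base.left + δ) * 2 ^ m) (base.right * 2 ^ m) := by
    rw [hbase.len_mul_avg]
    exact intervalSum_left_shift x m hδ hbase.left_nonneg hbase.left_lt_right h0 h1
  have hobj (h0 : 0 ≤ base.left + δ) (h1 : base.left + δ < base.right) :
      objective (base.len - δ * (2 : ℝ) ^ m) ((base.len * base.avg - δ * (2 : ℝ) ^ m *
        dyadicPower x m (min base.left (base.left + δ)).toNat) / (base.len - δ * (2 : ℝ) ^ m)) =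
        intervalObjective x ((base.left + δ) * 2 ^ m) (base.right * 2 ^ m) := by
    rw [hsum h0 h1, hL, intervalObjective_mul_two_pow]
  unfold tryLeft
  dsimp only
  split_ifs with h
  · obtain ⟨hlt, hLpos, h0⟩ := h
    have h1 := hpos.1 hLpos
    refine ⟨⟨h0, ?_, ?_, ?_, ?_, ?_⟩, hright, Or.inr rfl, hlt.le, fun _ _ => ?_⟩
    · simpa [hright] using h1
    · exact hcur.right_le
    · simpa [hright] using hL
    · dsimp only
      rw [hright, ← hsum h0 h1, mul_div_cancel₀ _ hLpos.ne']
    · dsimp only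
      rw [hright, hobj h0 h1]
    · exact (hobj h0 h1).ge
  · refine ⟨hcur, hright, Or.inl rfl, le_rfl, fun h0 h1 => ?_⟩
    rw [← hobj h0 h1]
    by_contra hlt
    exact h ⟨not_le.1 hlt, hpos.2 h1, h0⟩

theorem tryRight_spec {x : ℕ → ℝ} {m : ℕ} {bound δ : ℤ} {base cur : SearchState}
    (hδ : δ = -1 ∨ δ = 1) (hbase : base.IsConsistent x m bound)
    (hcur : cur.IsConsistent x m bound) (hleft : cur.left = base.left) :
    (tryRight x m bound base cur δ).IsConsistent x m bound ∧
      (tryRight x m bound base cur δ).left = base.left ∧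
      ((tryRight x m bound base cur δ).right = cur.right ∨
        (tryRight x m bound base cur δ).right = base.right + δ) ∧
      cur.best ≤ (tryRight x m bound base cur δ).best ∧
      (base.left < base.right + δ → base.right + δ ≤ bound →
        intervalObjective x (base.left * 2 ^ m) ((base.right + δ) * 2 ^ m) ≤
          (tryRight x m bound base cur δ).best) := by
  have hL : base.len + δ * (2 : ℝ) ^ m =
      (((base.right + δ : ℤ) : ℝ) - (base.left : ℝ)) * 2 ^ m := by
    rw [hbase.len_eq]; push_cast; ring
  have hpos : 0 < base.len + δ * (2 : ℝ) ^ m ↔ base.left < base.right + δ := by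
    rw [hL, mul_pos_iff_of_pos_right (by positivity), sub_pos, Int.cast_lt]
  have hsum (h1 : base.left < base.right + δ) :
      base.len * base.avg + δ * (2 : ℝ) ^ m *
        dyadicPower x m (min base.right (base.right + δ)).toNat =
        intervalSum x (base.left * 2 ^ m) ((base.right + δ) * 2 ^ m) := by
    rw [hbase.len_mul_avg]
    exact intervalSum_right_shift x m hδ hbase.left_nonneg hbase.left_lt_right h1
  have hobj (h1 : base.left < base.right + δ) :
      objective (base.len + δ * (2 : ℝ) ^ m) ((base.len * base.avg + δ * (2 : ℝ) ^ m *
        dyadicPower x m (min base.right (base.right + δ)).toNat) / (base.len + δ * (2 : ℝ) ^ m)) =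
        intervalObjective x (base.left * 2 ^ m) ((base.right + δ) * 2 ^ m) := by
    rw [hsum h1, hL, intervalObjective_mul_two_pow]
  unfold tryRight
  dsimp only
  split_ifs with h
  · obtain ⟨hlt, hLpos, h0⟩ := h
    have h1 := hpos.1 hLpos
    refine ⟨⟨hcur.left_nonneg, ?_, h0, ?_, ?_, ?_⟩, hleft, Or.inr rfl, hlt.le, fun _ _ => ?_⟩
    · simpa [hleft] using h1
    · simpa [hleft] using hL
    · dsimp only
      rw [hleft, ← hsum h1, mul_div_cancel₀ _ hLpos.ne']
    · dsimp only
      rw [hleft, hobj h1]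
    · exact (hobj h1).ge
  · refine ⟨hcur, hleft, Or.inl rfl, le_rfl, fun h1 h0 => ?_⟩
    rw [← hobj h1]
    by_contra hlt
    exact h ⟨not_le.1 hlt, hpos.2 h1, h0⟩

theorem SearchState.IsConsistent.refine {x : ℕ → ℝ} {m : ℕ} {bound : ℤ} {s : SearchState}
    (h : s.IsConsistent x (m + 1) bound) :
    ({ s with left := 2 * s.left, right := 2 * s.right } : SearchState).IsConsistent x m
      (2 * bound) := by
  have e (z : ℤ) : 2 * z * 2 ^ m = z * 2 ^ (m + 1) := by ring
  refine ⟨?_, ?_, ?_, ?_, ?_, ?_⟩ <;> dsimp only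
  · have := h.left_nonneg; omega
  · have := h.left_lt_right; omega
  · have := h.right_le; omega
  · rw [h.len_eq]; push_cast; ring
  · rw [h.len_mul_avg, e, e]
  · rw [h.best_eq, e, e]

/-- One iteration: both boundaries move by at most one sub-interval, and each of them maximizes the
objective among its admissible positions. -/
theorem searchStep_spec {x : ℕ → ℝ} {M t : ℕ} (ht : t < M) {s : SearchState}
    (h : s.IsConsistent x (M - t) (2 ^ t)) :
    (searchStep x M t s).IsConsistent x (M - (t + 1)) (2 ^ (t + 1)) ∧
    |(searchStep x M t s).left - 2 * s.left| ≤ 1 ∧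
    |(searchStep x M t s).right - 2 * s.right| ≤ 1 ∧
    (searchStep x M t s).left < 2 * s.right ∧
    (∀ c : ℤ, |c - 2 * s.left| ≤ 1 → 0 ≤ c → c < 2 * s.right →
      intervalObjective x (c * 2 ^ (M - (t + 1))) (2 * s.right * 2 ^ (M - (t + 1))) ≤
      intervalObjective x ((searchStep x M t s).left * 2 ^ (M - (t + 1)))
        (2 * s.right * 2 ^ (M - (t + 1)))) ∧
    (∀ d : ℤ, |d - 2 * s.right| ≤ 1 → (searchStep x M t s).left < d → d ≤ 2 ^ (t + 1) →
      intervalObjective x ((searchStep x M t s).left * 2 ^ (M - (t + 1)))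
        (d * 2 ^ (M - (t + 1))) ≤
      intervalObjective x ((searchStep x M t s).left * 2 ^ (M - (t + 1)))
        ((searchStep x M t s).right * 2 ^ (M - (t + 1)))) := by
  obtain ⟨m, rfl⟩ : ∃ m, M = t + 1 + m := ⟨M - (t + 1), by omega⟩
  have e1 : t + 1 + m - t = m + 1 := by omega
  have e2 : t + 1 + m - (t + 1) = m := by omega
  rw [e1] at h
  unfold searchStep
  rw [show t + 1 + m - t - 1 = m by omega, e2]
  dsimp only
  have h0 := h.refine
  rw [← pow_succ' (2 : ℤ) t] at h0
  set s₀ : SearchState := { s with left := 2 * s.left, right := 2 * s.right } with hs₀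
  have hl0 : s₀.left = 2 * s.left := rfl
  have hr0 : s₀.right = 2 * s.right := rfl
  rw [← hl0, ← hr0]
  clear_value s₀
  obtain ⟨ha, har, hal, hab, hac⟩ := tryLeft_spec (Or.inl rfl) h0 h0 rfl
  set sa := tryLeft x m s₀ s₀ (-1)
  obtain ⟨h1, h1r, h1l, h1b, h1c⟩ := tryLeft_spec (Or.inr rfl) h0 ha har
  set s₁ := tryLeft x m s₀ sa 1
  obtain ⟨hc, hcl, hcr, hcb, hcc⟩ := tryRight_spec (Or.inl rfl) h1 h1 rfl
  set sc := tryRight x m (2 ^ (t + 1)) s₁ s₁ (-1)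
  obtain ⟨h2, h2l, h2r, h2b, h2c⟩ := tryRight_spec (Or.inr rfl) h1 hc hcl
  set s₂ := tryRight x m (2 ^ (t + 1)) s₁ sc 1
  have hlt := h1.left_lt_right
  refine ⟨h2, ?_, ?_, ?_, ?_, ?_⟩
  · rw [h2l, abs_le]; omega
  · rw [abs_le]; omega
  · omega
  · intro c hc1 hc0 hcr'
    rw [h2l, ← h1r, ← h1.best_eq, h1r]
    rw [abs_le] at hc1
    -- Only weak inequalities are needed, so the tie-breaking order plays no role.
    obtain rfl | rfl | rfl : c = s₀.left ∨ c = s₀.left + -1 ∨ c = s₀.left + 1 := by omega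
    · rw [← h0.best_eq]; exact hab.trans h1b
    · exact (hac hc0 hcr').trans h1b
    · exact h1c hc0 hcr'
  · intro d hd1 hd0 hdN
    rw [← h2.best_eq, h2l]
    rw [h2l] at hd0
    rw [← h1r, abs_le] at hd1
    obtain rfl | rfl | rfl : d = s₁.right ∨ d = s₁.right + -1 ∨ d = s₁.right + 1 := by omega
    · rw [← h1.best_eq]; exact hcb.trans h2b
    · exact (hcc hd0 hdN).trans h2b
    · exact h2c hd0 hdN

theorem isConsistent_initState (x : ℕ → ℝ) (M : ℕ) : (initState x M).IsConsistent x M 1 := by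
  have h := two_pow_mul_dyadicPower_toNat x M (le_refl (0 : ℤ))
  rw [zero_add] at h
  refine ⟨le_rfl, zero_lt_one, le_rfl, ?_, ?_, ?_⟩ <;> dsimp only [initState]
  · simp
  · exact h
  · rw [intervalObjective_mul_two_pow, ← h]
    simp

theorem isConsistent_searchState (x : ℕ → ℝ) (M : ℕ) {t : ℕ} (ht : t ≤ M) :
    (searchState x M t).IsConsistent x (M - t) (2 ^ t) := by
  induction t with
  | zero => exact isConsistent_initState x M
  | succ t ih => exact (searchStep_spec ht (ih (by omega))).1

/-! ### Tracking of the true boundaries -/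

theorem intervalSum_eq_of_forall {p : ℕ → ℝ} {a b : ℤ} {v : ℝ} (ha : 0 ≤ a) (hab : a ≤ b)
    (h : ∀ n : ℕ, a ≤ n → (n : ℤ) < b → p n = v) : intervalSum p a b = v * ((b : ℝ) - a) := by
  lift a to ℕ using ha
  lift b to ℕ using (by omega)
  rw [intervalSum, Int.toNat_natCast, Int.toNat_natCast, Finset.sum_congr rfl (g := fun _ => v)]
  · rw [Finset.sum_const, Nat.card_Ico, nsmul_eq_mul, Nat.cast_sub (by omega)]
    push_cast
    ring
  · intro n hn
    rw [Finset.mem_Ico] at hn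
    exact h n (by omega) (by omega)

theorem intervalSum_le_of_forall {p : ℕ → ℝ} {a b : ℤ} {v : ℝ} (ha : 0 ≤ a) (hab : a ≤ b)
    (h : ∀ n : ℕ, p n ≤ v) : intervalSum p a b ≤ v * ((b : ℝ) - a) := by
  rw [← intervalSum_eq_of_forall (p := fun _ => v) ha hab (fun _ _ _ => rfl)]
  exact Finset.sum_le_sum fun n _ => h n

theorem one_le_meanPower {γ : ℝ} (hγ : 0 ≤ γ) (S : Finset ℤ) (n : ℕ) : 1 ≤ meanPower γ S n := by
  unfold meanPower
  split_ifs <;> linarith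

theorem meanPower_le {γ : ℝ} (hγ : 0 ≤ γ) (S : Finset ℤ) (n : ℕ) : meanPower γ S n ≤ 1 + γ := by
  unfold meanPower
  split_ifs <;> linarith

theorem intervalSum_meanPower_outside (γ : ℝ) {A B a b : ℤ} (ha : 0 ≤ a) (hab : a ≤ b)
    (h : b ≤ A ∨ B ≤ a) :
    intervalSum (meanPower γ (Finset.Ico A B)) a b = (b : ℝ) - a := by
  rw [intervalSum_eq_of_forall ha hab (v := 1), one_mul]
  intro n h1 h2
  rw [meanPower, if_neg]
  rw [Finset.mem_Ico]
  omega

theorem intervalSum_meanPower_inside (γ : ℝ) {A B a b : ℤ} (ha : 0 ≤ a) (hab : a ≤ b)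
    (hA : A ≤ a) (hB : b ≤ B) :
    intervalSum (meanPower γ (Finset.Ico A B)) a b = (1 + γ) * ((b : ℝ) - a) := by
  refine intervalSum_eq_of_forall ha hab fun n h1 h2 => ?_
  rw [meanPower, if_pos]
  rw [Finset.mem_Ico]
  omega

/-- All interval sums of `x` are within `δ N` of those of a signal of strength `γ` supported on
`[A, B) ⊆ [0, N)`, with `N = 2 ^ M`. -/
structure IsNearSignal (x : ℕ → ℝ) (M : ℕ) (A B : ℤ) (γ δ : ℝ) : Prop where
  left_nonneg : 0 ≤ A
  left_le_right : A ≤ B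
  right_le : B ≤ 2 ^ M
  abs_sub_le : ∀ a b : ℤ, 0 ≤ a → a ≤ b → b ≤ 2 ^ M →
    |intervalSum x a b - intervalSum (meanPower γ (Finset.Ico A B)) a b| ≤ δ * 2 ^ M

/-- The noise level `δ` is too small to spoil a comparison of two intervals whose objectives
are at least `j N` and which differ by at least `τ N` bins. -/
structure IsSmallNoise (j γ τ δ : ℝ) : Prop where
  j_pos : 0 < j
  γ_pos : 0 < γ
  nonneg : 0 ≤ δ
  lt_remove : δ < τ * (Real.log (1 + j) - 1 + (1 + j)⁻¹)
  le_half : 2 * δ ≤ j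
  le_sq : 4 * γ * δ ≤ j ^ 2
  lt_add : 2 * δ < τ * j

theorem exists_isSmallNoise {j γ τ : ℝ} (hj : 0 < j) (hγ : 0 < γ) (hτ : 0 < τ) :
    ∃ δ > 0, IsSmallNoise j γ τ δ := by
  have hlog : 0 < Real.log (1 + j) - 1 + (1 + j)⁻¹ := by
    have h1 : (1 + j)⁻¹ ≠ 1 := by
      intro h
      rw [inv_eq_one] at h
      linarith
    have h := Real.log_lt_sub_one_of_pos (show 0 < (1 + j)⁻¹ by positivity) h1
    rw [Real.log_inv] at h
    linarith
  -- One bound per requirement; the two strict ones are halved.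
  refine ⟨min (min (τ * (Real.log (1 + j) - 1 + (1 + j)⁻¹) / 2) (j / 2))
    (min (j ^ 2 / (4 * γ)) (τ * j / 4)), by positivity, hj, hγ, by positivity, ?_, ?_, ?_, ?_⟩
  · refine lt_of_le_of_lt ((min_le_left _ _).trans (min_le_left _ _)) ?_
    have : 0 < τ * (Real.log (1 + j) - 1 + (1 + j)⁻¹) := by positivity
    linarith
  · have := (min_le_left (min (τ * (Real.log (1 + j) - 1 + (1 + j)⁻¹) / 2) (j / 2))
      (min (j ^ 2 / (4 * γ)) (τ * j / 4))).trans (min_le_right _ _)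
    linarith
  · have := (min_le_right (min (τ * (Real.log (1 + j) - 1 + (1 + j)⁻¹) / 2) (j / 2))
      (min (j ^ 2 / (4 * γ)) (τ * j / 4))).trans (min_le_left _ _)
    rw [le_div_iff₀ (by positivity)] at this
    linarith
  · have := (min_le_right (min (τ * (Real.log (1 + j) - 1 + (1 + j)⁻¹) / 2) (j / 2))
      (min (j ^ 2 / (4 * γ)) (τ * j / 4))).trans (min_le_right _ _)
    have h0 : 0 < τ * j := by positivity
    linarith

namespace IsNearSignal

variable {x : ℕ → ℝ} {M : ℕ} {A B : ℤ} {γ δ j τ : ℝ}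

/-- An interval disjoint from the signal has excess at most `δ N`, hence objective at most `δ N < j
N`. -/
theorem overlap (hx : IsNearSignal x M A B γ δ) (hδ : IsSmallNoise j γ τ δ) {a b : ℤ}
    (ha : 0 ≤ a) (hab : a < b) (hb : b ≤ 2 ^ M) (hJ : j * 2 ^ M ≤ intervalObjective x a b) :
    A < b ∧ a < B := by
  by_contra hcon
  have hdisj : b ≤ A ∨ B ≤ a := by omega
  have h1 := hx.abs_sub_le a b ha hab.le hb
  rw [intervalSum_meanPower_outside γ ha hab.le hdisj, abs_le] at h1
  have hL : 0 < (b : ℝ) - a := by rw [sub_pos]; exact_mod_cast hab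
  have h2 := objective_le_max (s := intervalSum x a b) hL
  have hN : (0 : ℝ) < 2 ^ M := by positivity
  have h3 : max (intervalSum x a b - ((b : ℝ) - a)) 0 ≤ δ * 2 ^ M :=
    max_le h1.2 (mul_nonneg hδ.nonneg hN.le)
  have h4 : δ * 2 ^ M < j * 2 ^ M := by
    gcongr
    have := hδ.le_half
    have := hδ.j_pos
    linarith
  rw [intervalObjective] at hJ
  linarith

theorem length_le {a b : ℤ} (ha : 0 ≤ a) (hb : b ≤ 2 ^ M) : (b : ℝ) - a ≤ 2 ^ M := by
  have h1 : (0 : ℝ) ≤ a := by exact_mod_cast ha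
  have h2 : (b : ℝ) ≤ 2 ^ M := by exact_mod_cast hb
  linarith

theorem lt_remove_left (hx : IsNearSignal x M A B γ δ) (hδ : IsSmallNoise j γ τ δ) {a b l : ℤ}
    (ha : 0 ≤ a) (hab : a < b) (hb : b ≤ 2 ^ M) (hJ : j * 2 ^ M ≤ intervalObjective x a b)
    (hl : 0 < l) (hτ : τ * 2 ^ M ≤ l) (hA : a + l ≤ A) :
    intervalObjective x a b < intervalObjective x (a + l) b := by
  -- Overlap gives `a + l ≤ A < b`, so what is left after the cut is nonempty.
  have hov := (hx.overlap hδ ha hab hb hJ).1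
  have h1 := (abs_le.1 (hx.abs_sub_le a (a + l) ha (by omega) (by omega))).2
  rw [intervalSum_meanPower_outside γ ha (by omega) (Or.inl hA)] at h1
  have h2 := intervalSum_add x (show a ≤ a + l by omega) (show a + l ≤ b by omega)
  have h3 := objective_lt_of_remove (l := l) (d := intervalSum x a (a + l)) hδ.j_pos
    (show (0 : ℝ) < 2 ^ M by positivity) (by exact_mod_cast hl)
    (show (l : ℝ) < (b : ℝ) - a by rw [lt_sub_iff_add_lt']; exact_mod_cast (by omega : a + l < b))
    (length_le ha hb) hJ (by push_cast at h1; linarith) hτ hδ.nonneg hδ.lt_remove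
  rw [intervalObjective, intervalObjective]
  convert! h3 using 2
  · push_cast; ring
  · rw [← h2]; push_cast; congr 1 <;> ring

theorem lt_remove_right (hx : IsNearSignal x M A B γ δ) (hδ : IsSmallNoise j γ τ δ) {a b l : ℤ}
    (ha : 0 ≤ a) (hab : a < b) (hb : b ≤ 2 ^ M) (hJ : j * 2 ^ M ≤ intervalObjective x a b)
    (hl : 0 < l) (hτ : τ * 2 ^ M ≤ l) (hB : B ≤ b - l) :
    intervalObjective x a b < intervalObjective x a (b - l) := by
  have hov := (hx.overlap hδ ha hab hb hJ).2
  have h1 := (abs_le.1 (hx.abs_sub_le (b - l) b (by omega) (by omega) hb)).2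
  rw [intervalSum_meanPower_outside γ (by omega) (by omega) (Or.inr hB)] at h1
  have h2 := intervalSum_add x (show a ≤ b - l by omega) (show b - l ≤ b by omega)
  have h3 := objective_lt_of_remove (l := l) (d := intervalSum x (b - l) b) hδ.j_pos
    (show (0 : ℝ) < 2 ^ M by positivity) (by exact_mod_cast hl)
    (show (l : ℝ) < (b : ℝ) - a by rw [lt_sub_iff_add_lt']; exact_mod_cast (by omega : a + l < b))
    (length_le ha hb) hJ (by push_cast at h1; linarith) hτ hδ.nonneg hδ.lt_remove
  rw [intervalObjective, intervalObjective]
  convert! h3 using 2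
  · push_cast; ring
  · rw [← h2]; push_cast; congr 1 <;> ring

theorem intervalSum_le (hx : IsNearSignal x M A B γ δ) (hδ : IsSmallNoise j γ τ δ) {a b : ℤ}
    (ha : 0 ≤ a) (hab : a ≤ b) (hb : b ≤ 2 ^ M) :
    intervalSum x a b ≤ (1 + γ) * ((b : ℝ) - a) + δ * 2 ^ M := by
  have h1 := (abs_le.1 (hx.abs_sub_le a b ha hab hb)).2
  have h2 := intervalSum_le_of_forall ha hab (meanPower_le hδ.γ_pos.le (Finset.Ico A B))
  linarith

theorem lt_add_left (hx : IsNearSignal x M A B γ δ) (hδ : IsSmallNoise j γ τ δ) {a b l : ℤ}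
    (ha : 0 ≤ a) (hab : a < b) (hb : b ≤ 2 ^ M) (hJ : j * 2 ^ M ≤ intervalObjective x a b)
    (hl : 0 < l) (hτ : τ * 2 ^ M ≤ l) (hA : A ≤ a - l) :
    intervalObjective x a b < intervalObjective x (a - l) b := by
  have hA0 := hx.left_nonneg
  have hov := (hx.overlap hδ ha hab hb hJ).2
  -- Overlap gives `a < B`, so the added piece `[a - l, a)` lies inside the signal.
  have h1 := (abs_le.1 (hx.abs_sub_le (a - l) a (by omega) (by omega) (by omega))).1
  rw [intervalSum_meanPower_inside γ (by omega) (by omega) hA hov.le] at h1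
  have h2 := intervalSum_add x (show a - l ≤ a by omega) hab.le
  have h3 := objective_lt_of_add (l := l) (d := intervalSum x (a - l) a) hδ.j_pos hδ.γ_pos
    (show (0 : ℝ) < 2 ^ M by positivity) (by exact_mod_cast hl)
    (show 0 < (b : ℝ) - a by rw [sub_pos]; exact_mod_cast hab)
    (length_le ha hb) hJ (hx.intervalSum_le hδ ha hab.le hb)
    (by push_cast at h1; linarith) hτ hδ.nonneg hδ.le_half hδ.le_sq hδ.lt_add
  rw [intervalObjective, intervalObjective]
  convert! h3 using 2
  · push_cast; ring
  · rw [← h2]; push_cast; congr 1 <;> ring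

theorem lt_add_right (hx : IsNearSignal x M A B γ δ) (hδ : IsSmallNoise j γ τ δ) {a b l : ℤ}
    (ha : 0 ≤ a) (hab : a < b) (hb : b ≤ 2 ^ M) (hJ : j * 2 ^ M ≤ intervalObjective x a b)
    (hl : 0 < l) (hτ : τ * 2 ^ M ≤ l) (hB : b + l ≤ B) :
    intervalObjective x a b < intervalObjective x a (b + l) := by
  have hBN := hx.right_le
  have hov := (hx.overlap hδ ha hab hb hJ).1
  have h1 := (abs_le.1 (hx.abs_sub_le b (b + l) (by omega) (by omega) (by omega))).1
  rw [intervalSum_meanPower_inside γ (by omega) (by omega) hov.le hB] at h1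
  have h2 := intervalSum_add x hab.le (show b ≤ b + l by omega)
  have h3 := objective_lt_of_add (l := l) (d := intervalSum x b (b + l)) hδ.j_pos hδ.γ_pos
    (show (0 : ℝ) < 2 ^ M by positivity) (by exact_mod_cast hl)
    (show 0 < (b : ℝ) - a by rw [sub_pos]; exact_mod_cast hab)
    (length_le ha hb) hJ (hx.intervalSum_le hδ ha hab.le hb)
    (by push_cast at h1; linarith) hτ hδ.nonneg hδ.le_half hδ.le_sq hδ.lt_add
  rw [intervalObjective, intervalObjective]
  convert! h3 using 2
  · push_cast; ring
  · rw [← h2]; push_cast; congr 1; ring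

end IsNearSignal

/-- As long as the sub-intervals have at least `τ N` bins, the boundaries stay within one
sub-interval of the true ones. -/
theorem IsNearSignal.tracking {x : ℕ → ℝ} {M : ℕ} {A B : ℤ} {γ δ j τ : ℝ}
    (hx : IsNearSignal x M A B γ δ) (hδ : IsSmallNoise j γ τ δ)
    (h0 : j * 2 ^ M ≤ intervalObjective x 0 (2 ^ M)) {t : ℕ} (ht : t ≤ M)
    (hτ : τ * 2 ^ M ≤ 2 ^ (M - t)) :
    j * 2 ^ M ≤ intervalObjective x ((searchState x M t).left * 2 ^ (M - t))
        ((searchState x M t).right * 2 ^ (M - t)) ∧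
      |(searchState x M t).left * 2 ^ (M - t) - A| ≤ 2 ^ (M - t) ∧
      |(searchState x M t).right * 2 ^ (M - t) - B| ≤ 2 ^ (M - t) := by
  induction t with
  | zero =>
    have h1 := hx.left_nonneg
    have h2 := hx.left_le_right
    have h3 := hx.right_le
    simp only [searchState, initState, Nat.sub_zero, zero_mul, one_mul]
    refine ⟨h0, ?_, ?_⟩ <;> rw [abs_le] <;> constructor <;> linarith
  | succ t ih =>
    have hpow : (2 : ℤ) ^ (M - t) = 2 * 2 ^ (M - (t + 1)) := by
      rw [← pow_succ']; congr 1; omega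
    have hpowR : (2 : ℝ) ^ (M - t) = 2 * 2 ^ (M - (t + 1)) := by exact_mod_cast hpow
    have hlR : (0 : ℝ) < 2 ^ (M - (t + 1)) := by positivity
    obtain ⟨ihJ, ihA, ihB⟩ := ih (by omega) (by rw [hpowR]; linarith)
    have hcons := isConsistent_searchState x M (show t ≤ M by omega)
    obtain ⟨hcons', hdl, hdr, hlr, hoptl, hoptr⟩ := searchStep_spec (show t < M by omega) hcons
    change j * 2 ^ M ≤ intervalObjective x ((searchStep x M t (searchState x M t)).left * _)
        ((searchStep x M t (searchState x M t)).right * _) ∧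
      |(searchStep x M t (searchState x M t)).left * _ - A| ≤ _ ∧
      |(searchStep x M t (searchState x M t)).right * _ - B| ≤ _
    have hNN : (2 : ℤ) ^ M = 2 ^ (t + 1) * 2 ^ (M - (t + 1)) := by
      rw [← pow_add]; congr 1; omega
    set s := searchState x M t
    set s' := searchStep x M t s
    have hl : (0 : ℤ) < 2 ^ (M - (t + 1)) := by positivity
    have hτl : τ * 2 ^ M ≤ (((2 : ℤ) ^ (M - (t + 1)) : ℤ) : ℝ) := by exact_mod_cast hτ
    set l : ℤ := 2 ^ (M - (t + 1)) with hldef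
    have hle (z : ℤ) : z * 2 ^ (M - t) = 2 * z * l := by rw [hpow]; ring
    rw [hle, hpow] at ihA ihB
    rw [hle, hle] at ihJ
    have hsl := hcons.left_nonneg
    have hslr := hcons.left_lt_right
    have hsr := hcons.right_le
    have hsl' := hcons'.left_nonneg
    have hslr' := hcons'.left_lt_right
    have hsr' := hcons'.right_le
    have hmul {u v : ℤ} (h : u ≤ v) : u * l ≤ v * l := mul_le_mul_of_nonneg_right h hl.le
    have hmul' {u v : ℤ} (h : u < v) : u * l < v * l := mul_lt_mul_of_pos_right h hl
    have hcancel {u v : ℤ} (h : u * l < v * l) : u < v := lt_of_mul_lt_mul_right h hl.le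
    have hrN : 2 * s.right * l ≤ 2 ^ M := by
      rw [hNN]
      refine hmul ?_
      rw [pow_succ]; linarith
    -- Staying put is a candidate in both updates, so the lower bound `j N` persists.
    have hJ1 : j * 2 ^ M ≤ intervalObjective x (s'.left * l) (2 * s.right * l) :=
      ihJ.trans (hoptl _ (by simp) (by omega) (by omega))
    have hJ2 : j * 2 ^ M ≤ intervalObjective x (s'.left * l) (s'.right * l) :=
      hJ1.trans (hoptr _ (by simp) hlr (by rw [pow_succ]; linarith))
    have hl0 : 0 ≤ s'.left * l := by positivity
    have hrN' : s'.right * l ≤ 2 ^ M := by rw [hNN]; exact hmul hsr'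
    have hovl := hx.overlap hδ hl0 (hmul' hlr) hrN hJ1
    have hovr := hx.overlap hδ hl0 (hmul' hslr') hrN' hJ2
    have hA0 := hx.left_nonneg
    have hBN := hx.right_le
    rw [abs_le] at ihA ihB hdl hdr
    -- The old boundary was within two new sub-intervals of its target. If the new one is off by
    -- more than one, it has not already moved one step towards the target, so its neighbour on that
    -- side is still a candidate, and a strictly better one.
    refine ⟨hJ2, ?_, ?_⟩ <;> rw [abs_le] <;> constructor <;> by_contra! hcon
    · have hc : s'.left < 2 * s.left + 1 := hcancel (by rw [add_mul, one_mul]; linarith)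
      have hlt := hx.lt_remove_left hδ hl0 (hmul' hlr) hrN hJ1 hl hτl (by linarith)
      have hopt := hoptl (s'.left + 1) (by rw [abs_le]; omega) (by omega)
        (hcancel (by rw [add_mul, one_mul]; linarith))
      rw [add_mul, one_mul] at hopt
      linarith
    · have hc : 2 * s.left - 1 < s'.left := hcancel (by rw [sub_mul, one_mul]; linarith)
      have hlt := hx.lt_add_left hδ hl0 (hmul' hlr) hrN hJ1 hl hτl (by linarith)
      have hc0 : 0 < s'.left := hcancel (by rw [zero_mul]; linarith)
      have hopt := hoptl (s'.left - 1) (by rw [abs_le]; omega) (by omega) (by omega)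
      rw [sub_mul, one_mul] at hopt
      linarith
    · have hc : s'.right < 2 * s.right + 1 := hcancel (by rw [add_mul, one_mul]; linarith)
      have hlt := hx.lt_add_right hδ hl0 (hmul' hslr') hrN' hJ2 hl hτl (by linarith)
      have hcN : s'.right < 2 ^ (t + 1) := hcancel (by rw [← hNN]; linarith)
      have hopt := hoptr (s'.right + 1) (by rw [abs_le]; omega) (by omega) (by omega)
      rw [add_mul, one_mul] at hopt
      linarith
    · have hc : 2 * s.right - 1 < s'.right := hcancel (by rw [sub_mul, one_mul]; linarith)
      have hlt := hx.lt_remove_right hδ hl0 (hmul' hslr') hrN' hJ2 hl hτl (by linarith)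
      have hopt := hoptr (s'.right - 1) (by rw [abs_le]; omega)
        (hcancel (by rw [sub_mul, one_mul]; linarith)) (by omega)
      rw [sub_mul, one_mul] at hopt
      linarith

/-- After `T` iterations the boundaries move by less than `2 ^ (M - T)` bins in total. -/
theorem abs_searchState_sub_le (x : ℕ → ℝ) {M T t : ℕ} (hT : T ≤ t) (ht : t ≤ M) :
    |(searchState x M t).left * 2 ^ (M - t) - (searchState x M T).left * 2 ^ (M - T)| ≤
        2 ^ (M - T) - 2 ^ (M - t) ∧
      |(searchState x M t).right * 2 ^ (M - t) - (searchState x M T).right * 2 ^ (M - T)| ≤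
        2 ^ (M - T) - 2 ^ (M - t) := by
  induction t, hT using Nat.le_induction with
  | base => simp
  | succ t hTt ih =>
    obtain ⟨ihl, ihr⟩ := ih (by omega)
    obtain ⟨-, hdl, hdr, -⟩ := searchStep_spec (show t < M by omega)
      (isConsistent_searchState x M (show t ≤ M by omega))
    change |(searchStep x M t (searchState x M t)).left * _ - _| ≤ _ ∧
      |(searchStep x M t (searchState x M t)).right * _ - _| ≤ _
    set s := searchState x M t
    set s' := searchStep x M t s
    have hpow : (2 : ℤ) ^ (M - t) = 2 * 2 ^ (M - (t + 1)) := by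
      rw [← pow_succ']; congr 1; omega
    have hl : (0 : ℤ) < 2 ^ (M - (t + 1)) := by positivity
    rw [hpow] at ihl ihr
    rw [abs_le] at ihl ihr hdl hdr
    -- A move of `2 ^ (M - t - 1)` equals `2 ^ (M - t) - 2 ^ (M - t - 1)`, so the bounds telescope.
    refine ⟨abs_le.2 ⟨?_, ?_⟩, abs_le.2 ⟨?_, ?_⟩⟩ <;> nlinarith

/-! ### Intersection over union -/

theorem IoU_le_one (S T : Finset ℤ) : IoU S T ≤ 1 := by
  refine div_le_one_of_le₀ ?_ (by positivity)
  exact_mod_cast Finset.card_le_card (Finset.inter_subset_left.trans Finset.subset_union_left)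

/-- The intersection loses at most `2 η` and the union gains at most `2 η` against `B - A`, while
the union has at least `B - A` elements. -/
theorem one_sub_IoU_Ico_le {a b A B η : ℤ} (hAB : A < B) (ha : |a - A| ≤ η) (hb : |b - B| ≤ η) :
    1 - IoU (Finset.Ico a b) (Finset.Ico A B) ≤ 4 * η / ((B : ℝ) - A) := by
  set I := (Finset.Ico a b ∩ Finset.Ico A B).card with hI
  set U := (Finset.Ico a b ∪ Finset.Ico A B).card with hU
  rw [abs_le] at ha hb
  have hIlow : B - A - 2 * η ≤ I := by
    rw [hI, Finset.Ico_inter_Ico, Int.card_Ico]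
    omega
  have hUlow : B - A ≤ U := by
    have h := Finset.card_le_card
      (Finset.subset_union_right (s₁ := Finset.Ico a b) (s₂ := Finset.Ico A B))
    rw [Int.card_Ico] at h
    omega
  have hUup : (U : ℤ) ≤ B - A + 2 * η := by
    have h := Finset.card_le_card (show Finset.Ico a b ∪ Finset.Ico A B ⊆
      Finset.Ico (min a A) (max b B) by
        intro n
        simp only [Finset.mem_union, Finset.mem_Ico]
        omega)
    rw [Int.card_Ico] at h
    omega
  have hAB' : (0 : ℝ) < (B : ℝ) - A := by rw [sub_pos]; exact_mod_cast hAB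
  have h1 : (B : ℝ) - A - 2 * η ≤ I := by exact_mod_cast hIlow
  have h2 : (B : ℝ) - A ≤ U := by exact_mod_cast hUlow
  have h3 : (U : ℝ) ≤ B - A + 2 * η := by exact_mod_cast hUup
  have hη : (0 : ℝ) ≤ η := by exact_mod_cast (by omega : 0 ≤ η)
  have hU0 : (0 : ℝ) < U := hAB'.trans_le h2
  rw [IoU, ← hI, ← hU, one_sub_div hU0.ne']
  exact div_le_div₀ (by positivity) (by linarith) hAB' h2

theorem IsNearSignal.one_sub_IoU_le {x : ℕ → ℝ} {M T t : ℕ} {A B : ℤ} {γ δ j : ℝ}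
    (hx : IsNearSignal x M A B γ δ) (hδ : IsSmallNoise j γ ((2 : ℝ) ^ T)⁻¹ δ) (hAB : A < B)
    (h0 : j * 2 ^ M ≤ intervalObjective x 0 (2 ^ M)) (hTM : T ≤ M) (hTt : T ≤ t) :
    1 - IoU (estimatedInterval x M t) (Finset.Ico A B) ≤ 8 * 2 ^ (M - T) / ((B : ℝ) - A) := by
  have hT : T ≤ min t M := le_min hTt hTM
  have hpow : ((2 : ℝ) ^ T)⁻¹ * 2 ^ M = 2 ^ (M - T) := by
    rw [pow_sub₀ _ two_ne_zero hTM, mul_comm]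
  obtain ⟨-, hl, hr⟩ := hx.tracking hδ h0 hTM hpow.le
  obtain ⟨hl', hr'⟩ := abs_searchState_sub_le x hT (min_le_right t M)
  have hpos : (0 : ℤ) < 2 ^ (M - min t M) := by positivity
  rw [abs_le] at hl hr hl' hr'
  -- In `η`, one `2 ^ (M - T)` comes from tracking up to `T`, the other from all later moves.
  have h := one_sub_IoU_Ico_le (a := (searchState x M (min t M)).left * 2 ^ (M - min t M))
    (b := (searchState x M (min t M)).right * 2 ^ (M - min t M)) (η := 2 * 2 ^ (M - T)) hAB
    (abs_le.2 ⟨by linarith, by linarith⟩) (abs_le.2 ⟨by linarith, by linarith⟩)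
  rw [estimatedInterval]
  refine h.trans (le_of_eq ?_)
  push_cast
  ring

/-- Supplies the starting value of the search: the tangent at any `z` not exceeding the average of
`[0, N)` gives the bound. -/
theorem IsNearSignal.le_intervalObjective {x : ℕ → ℝ} {M : ℕ} {A B : ℤ} {γ δ z : ℝ}
    (hx : IsNearSignal x M A B γ δ) (hz : 1 ≤ z)
    (h : z * 2 ^ M ≤ 2 ^ M + γ * ((B : ℝ) - A) - δ * 2 ^ M) :
    (z - 1 - Real.log z) * 2 ^ M ≤ intervalObjective x 0 (2 ^ M) := by
  have hA := hx.left_nonneg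
  have hAB := hx.left_le_right
  have hB := hx.right_le
  have h1 := (abs_le.1 (hx.abs_sub_le 0 (2 ^ M) le_rfl (by positivity) le_rfl)).1
  rw [← intervalSum_add (meanPower _ _) hA (hAB.trans hB),
    ← intervalSum_add (meanPower _ _) hAB hB,
    intervalSum_meanPower_outside γ le_rfl hA (Or.inl le_rfl),
    intervalSum_meanPower_inside γ hA hAB le_rfl le_rfl,
    intervalSum_meanPower_outside γ (hA.trans hAB) hB (Or.inr le_rfl)] at h1
  push_cast at h1
  have hN : (0 : ℝ) < 2 ^ M := by positivity
  have h2 := mul_sub_mul_log_le_objective (intervalSum x 0 (2 ^ M)) hN hz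
  have hz0 : 0 < z := by linarith
  have hinv : z * z⁻¹ = 1 := mul_inv_cancel₀ hz0.ne'
  have hinv1 : z⁻¹ ≤ 1 := inv_le_one_of_one_le₀ hz
  have h3 : z * 2 ^ M * (1 - z⁻¹) ≤ intervalSum x 0 (2 ^ M) * (1 - z⁻¹) :=
    mul_le_mul_of_nonneg_right (by linarith) (by linarith)
  have h4 : z * 2 ^ M * (1 - z⁻¹) = (z - 1) * 2 ^ M := by linear_combination (-2 ^ M) * hinv
  rw [intervalObjective]
  push_cast
  rw [sub_zero]
  linarith

/-! ### Uniform law of large numbers for the prefix sums -/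

open MeasureTheory ProbabilityTheory Filter Topology

/-- A Gamma integral. With `k ≠ 0` the integrand vanishes at `0`, so the half-line may be taken
open. -/
theorem integrable_and_integral_pow_expMeasure {r : ℝ} (hr : 0 < r) {k : ℕ} (hk : k ≠ 0) :
    Integrable (fun x : ℝ => x ^ k) (expMeasure r) ∧
      ∫ x, x ^ k ∂(expMeasure r) = k.factorial / r ^ k := by
  have hdens : ∀ x : ℝ, (exponentialPDF r x).toReal * x ^ k =
      (Set.Ioi (0 : ℝ)).indicator
        (fun x => r * (x ^ ((k + 1 : ℝ) - 1) * Real.exp (-(r * x)))) x := by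
    intro x
    rcases lt_trichotomy x 0 with hx | rfl | hx
    · rw [exponentialPDF_of_neg hx, Set.indicator_of_notMem (by simpa using hx.le)]
      simp
    · rw [Set.indicator_of_notMem (by simp), zero_pow hk, mul_zero]
    · rw [exponentialPDF_of_nonneg hx.le, Set.indicator_of_mem (by simpa using hx),
        ENNReal.toReal_ofReal (by positivity), add_sub_cancel_right, Real.rpow_natCast]
      ring
  have hval : ∫ x in Set.Ioi (0 : ℝ), r * (x ^ ((k + 1 : ℝ) - 1) * Real.exp (-(r * x))) =
      k.factorial / r ^ k := by
    rw [integral_const_mul, Real.integral_rpow_mul_exp_neg_mul_Ioi (by positivity) hr,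
      Real.Gamma_nat_eq_factorial, show ((k : ℝ) + 1) = ((k + 1 : ℕ) : ℝ) by push_cast; rfl,
      Real.rpow_natCast, div_pow, one_pow, pow_succ]
    field_simp
  have hint : IntegrableOn (fun x => r * (x ^ ((k + 1 : ℝ) - 1) * Real.exp (-(r * x))))
      (Set.Ioi (0 : ℝ)) := by
    -- A non-integrable function would have integral `0` by convention, but the value is positive.
    by_contra h
    rw [integral_undef h] at hval
    have : (0 : ℝ) < k.factorial / r ^ k := by positivity
    linarith
  have hmeas : Measurable (exponentialPDF r) :=
    (measurable_exponentialPDFReal r).ennreal_ofReal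
  have hlt : ∀ᵐ x, exponentialPDF r x < ⊤ := ae_of_all _ fun _ => ENNReal.ofReal_lt_top
  have hexp : expMeasure r = volume.withDensity (exponentialPDF r) := rfl
  rw [hexp]
  constructor
  · rw [integrable_withDensity_iff_integrable_smul' hmeas hlt]
    simp_rw [smul_eq_mul, hdens]
    exact hint.integrable_indicator measurableSet_Ioi
  · rw [integral_withDensity_eq_integral_toReal_smul hmeas hlt]
    simp_rw [smul_eq_mul, hdens]
    rw [integral_indicator measurableSet_Ioi, hval]

theorem ae_nonneg_expMeasure (r : ℝ) : ∀ᵐ x ∂(expMeasure r), 0 ≤ x := by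
  have hexp : expMeasure r = volume.withDensity (exponentialPDF r) := rfl
  have hmeas : Measurable (exponentialPDF r) :=
    (measurable_exponentialPDFReal r).ennreal_ofReal
  rw [hexp, ae_withDensity_iff hmeas]
  refine ae_of_all _ fun x hx => ?_
  by_contra h
  exact hx (exponentialPDF_of_neg (not_le.1 h))

section

variable {Ω : Type*} [MeasurableSpace Ω] {μ : Measure Ω}

theorem integral_of_hasLaw_exp {Y : Ω → ℝ} {p : ℝ} (hp : 0 < p)
    (hY : HasLaw Y (expMeasure p⁻¹) μ) : ∫ ω, Y ω ∂μ = p := by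
  rw [hY.integral_eq]
  simpa using (integrable_and_integral_pow_expMeasure (inv_pos.2 hp) one_ne_zero).2

theorem memLp_two_of_hasLaw_exp {Y : Ω → ℝ} {p : ℝ} (hp : 0 < p)
    (hY : HasLaw Y (expMeasure p⁻¹) μ) : MemLp Y 2 μ := by
  rw [memLp_two_iff_integrable_sq hY.aemeasurable.aestronglyMeasurable]
  have h := (integrable_and_integral_pow_expMeasure (inv_pos.2 hp) two_ne_zero).1
  rw [← hY.map_eq] at h
  exact h.comp_aemeasurable hY.aemeasurable

variable [IsProbabilityMeasure μ]

theorem variance_le_of_hasLaw_exp {Y : Ω → ℝ} {p : ℝ} (hp : 0 < p)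
    (hY : HasLaw Y (expMeasure p⁻¹) μ) : variance Y μ ≤ 2 * p ^ 2 := by
  refine (variance_le_expectation_sq hY.aemeasurable.aestronglyMeasurable).trans (le_of_eq ?_)
  obtain ⟨h1, h2⟩ := integrable_and_integral_pow_expMeasure (inv_pos.2 hp) two_ne_zero
  have h3 := hY.integral_comp h1.aestronglyMeasurable
  rw [h2] at h3
  simpa [Function.comp_def] using h3

/-- Chebyshev's inequality, with each variance bounded crudely by the second moment. -/
theorem measure_prefix_deviation_le {Y : ℕ → Ω → ℝ} {p : ℕ → ℝ} {N k : ℕ} {P c : ℝ}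
    (hp : ∀ n, 0 < p n) (hP : ∀ n, p n ≤ P)
    (hlaw : ∀ n < N, HasLaw (Y n) (expMeasure (p n)⁻¹) μ)
    (hindep : iIndepFun (fun n : Fin N => Y n) μ) (hk : k ≤ N) (hc : 0 < c) :
    μ {ω | c ≤ |∑ n ∈ Finset.range k, Y n ω - ∑ n ∈ Finset.range k, p n|} ≤
      ENNReal.ofReal (N * (2 * P ^ 2) / c ^ 2) := by
  have hlt {n : ℕ} (hn : n ∈ Finset.range k) : n < N := (Finset.mem_range.1 hn).trans_le hk
  have hmem : ∀ n ∈ Finset.range k, MemLp (Y n) 2 μ := fun n hn =>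
    memLp_two_of_hasLaw_exp (hp n) (hlaw n (hlt hn))
  have hmean : ∫ ω, (∑ n ∈ Finset.range k, Y n) ω ∂μ = ∑ n ∈ Finset.range k, p n := by
    simp_rw [Finset.sum_apply]
    rw [integral_finsetSum _ fun n hn => (hmem n hn).integrable one_le_two]
    exact Finset.sum_congr rfl fun n hn => integral_of_hasLaw_exp (hp n) (hlaw n (hlt hn))
  have hvar : variance (∑ n ∈ Finset.range k, Y n) μ ≤ N * (2 * P ^ 2) := by
    rw [IndepFun.variance_sum hmem]
    · calc ∑ n ∈ Finset.range k, variance (Y n) μ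
          ≤ ∑ n ∈ Finset.range k, 2 * P ^ 2 := by
            refine Finset.sum_le_sum fun n hn => ?_
            refine (variance_le_of_hasLaw_exp (hp n) (hlaw n (hlt hn))).trans ?_
            have h1 := hp n
            have h2 := hP n
            gcongr
        _ = k * (2 * P ^ 2) := by simp
        _ ≤ N * (2 * P ^ 2) := by gcongr
    · intro i hi j hj hij
      exact hindep.indepFun (i := ⟨i, hlt hi⟩) (j := ⟨j, hlt hj⟩) (by simpa using hij)
  have h := meas_ge_le_variance_div_sq (memLp_finsetSum' _ hmem) hc
  rw [hmean] at h
  simp_rw [Finset.sum_apply] at h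
  refine h.trans (ENNReal.ofReal_le_ofReal ?_)
  gcongr

/-- The Chebyshev bound is of order `1 / N = 2⁻ᴹ`, hence summable over powers of two. The first
Borel–Cantelli lemma then needs no relation between different `M`. -/
theorem ae_eventually_prefix_deviation_lt {X : ℕ → ℕ → Ω → ℝ} {p : ℕ → ℕ → ℝ} {P ε : ℝ}
    (hp : ∀ M n, 0 < p M n) (hP : ∀ M n, p M n ≤ P)
    (hlaw : ∀ M n : ℕ, n < 2 ^ M → HasLaw (X M n) (expMeasure (p M n)⁻¹) μ)
    (hindep : ∀ M : ℕ, iIndepFun (fun n : Fin (2 ^ M) => X M n) μ) (hε : 0 < ε) (k : ℕ → ℕ) :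
    ∀ᵐ ω ∂μ, ∀ᶠ M in atTop, k M ≤ 2 ^ M →
      |∑ n ∈ Finset.range (k M), X M n ω - ∑ n ∈ Finset.range (k M), p M n| < ε * 2 ^ M := by
  have hbound (M : ℕ) : μ {ω | k M ≤ 2 ^ M ∧ ε * 2 ^ M ≤
      |∑ n ∈ Finset.range (k M), X M n ω - ∑ n ∈ Finset.range (k M), p M n|} ≤
      ENNReal.ofReal (2 * P ^ 2 / ε ^ 2 * (1 / 2) ^ M) := by
    by_cases hk : k M ≤ 2 ^ M
    · simp only [hk, true_and]
      refine (measure_prefix_deviation_le (hp M) (hP M) (hlaw M) (hindep M) hk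
        (by positivity)).trans (ENNReal.ofReal_le_ofReal (le_of_eq ?_))
      push_cast
      rw [div_pow, one_pow]
      field_simp
    · simp [hk]
  have hsum : Summable fun M : ℕ => 2 * P ^ 2 / ε ^ 2 * (1 / 2 : ℝ) ^ M :=
    summable_geometric_two.mul_left _
  have hfin := ne_top_of_le_ne_top hsum.tsum_ofReal_ne_top (ENNReal.tsum_le_tsum hbound)
  filter_upwards [ae_eventually_notMem hfin] with ω hω
  filter_upwards [hω] with M hM hk
  by_contra h
  exact hM ⟨hk, not_lt.1 h⟩

end

/-- Monotonicity of prefix sums extends a bound of their deviations from a grid to all indices. -/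
theorem abs_prefix_sub_le_of_grid {x p : ℕ → ℝ} {q d : ℕ} {P ε : ℝ} (hd : 0 < d)
    (hx : ∀ n < q * d, 0 ≤ x n) (hp : ∀ n, 0 ≤ p n) (hP : ∀ n, p n ≤ P)
    (hgrid : ∀ i ≤ q, |∑ n ∈ Finset.range (i * d), x n - ∑ n ∈ Finset.range (i * d), p n| ≤ ε)
    {k : ℕ} (hk : k ≤ q * d) :
    |∑ n ∈ Finset.range k, x n - ∑ n ∈ Finset.range k, p n| ≤ ε + P * d := by
  have hP0 : 0 ≤ P := (hp 0).trans (hP 0)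
  rcases hk.eq_or_lt with rfl | hk
  · refine (hgrid q le_rfl).trans ?_
    have : 0 ≤ P * d := by positivity
    linarith
  -- Both prefix sums at `k` lie between their values at neighbouring grid points, where the means
  -- differ by at most `P d`.
  set i := k / d
  have hi1 : i * d ≤ k := Nat.div_mul_le_self k d
  have hi2 : k < (i + 1) * d := by
    rw [mul_comm]; exact Nat.lt_mul_div_succ k hd
  have hiq : i + 1 ≤ q := (Nat.div_lt_iff_lt_mul hd).2 hk
  have hiqd : (i + 1) * d ≤ q * d := Nat.mul_le_mul_right d hiq
  have hxmono {u v : ℕ} (huv : u ≤ v) (hv : v ≤ q * d) :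
      ∑ n ∈ Finset.range u, x n ≤ ∑ n ∈ Finset.range v, x n :=
    Finset.sum_le_sum_of_subset_of_nonneg (Finset.range_mono huv) fun n hn _ =>
      hx n ((Finset.mem_range.1 hn).trans_le hv)
  have hpmono {u v : ℕ} (huv : u ≤ v) : ∑ n ∈ Finset.range u, p n ≤ ∑ n ∈ Finset.range v, p n :=
    Finset.sum_le_sum_of_subset_of_nonneg (Finset.range_mono huv) fun n _ _ => hp n
  have hstep : ∑ n ∈ Finset.range ((i + 1) * d), p n ≤
      ∑ n ∈ Finset.range (i * d), p n + P * d := by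
    rw [← Finset.sum_range_add_sum_Ico p (show i * d ≤ (i + 1) * d by gcongr; omega)]
    gcongr
    calc ∑ n ∈ Finset.Ico (i * d) ((i + 1) * d), p n
        ≤ ∑ n ∈ Finset.Ico (i * d) ((i + 1) * d), P := Finset.sum_le_sum fun n _ => hP n
      _ = P * d := by
        rw [Finset.sum_const, Nat.card_Ico, add_one_mul, Nat.add_sub_cancel_left, nsmul_eq_mul,
          mul_comm]
  have h1 := abs_le.1 (hgrid i (by omega))
  have h2 := abs_le.1 (hgrid (i + 1) hiq)
  have h3 := hxmono hi1 hk.le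
  have h4 := hxmono hi2.le hiqd
  have h5 := hpmono hi1
  have h6 := hpmono hi2.le
  rw [abs_le]
  constructor <;> linarith

theorem abs_intervalSum_sub_le {x p : ℕ → ℝ} {N : ℕ} {ε : ℝ}
    (h : ∀ k ≤ N, |∑ n ∈ Finset.range k, x n - ∑ n ∈ Finset.range k, p n| ≤ ε) {a b : ℤ}
    (hab : a ≤ b) (hb : b ≤ N) : |intervalSum x a b - intervalSum p a b| ≤ 2 * ε := by
  have hab' := Int.toNat_le_toNat hab
  have h1 := abs_le.1 (h a.toNat (by omega))
  have h2 := abs_le.1 (h b.toNat (by omega))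
  rw [intervalSum, intervalSum, Finset.sum_Ico_eq_sub _ hab', Finset.sum_Ico_eq_sub _ hab', abs_le]
  constructor <;> linarith

theorem ae_eventually_abs_intervalSum_sub_le {Ω : Type*} [MeasurableSpace Ω] {μ : Measure Ω}
    [IsProbabilityMeasure μ] {X : ℕ → ℕ → Ω → ℝ} {p : ℕ → ℕ → ℝ} {P : ℝ}
    (hp : ∀ M n, 0 < p M n) (hP : ∀ M n, p M n ≤ P)
    (hlaw : ∀ M n : ℕ, n < 2 ^ M → HasLaw (X M n) (expMeasure (p M n)⁻¹) μ)
    (hindep : ∀ M : ℕ, iIndepFun (fun n : Fin (2 ^ M) => X M n) μ) :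
    ∀ᵐ ω ∂μ, ∀ δ > 0, ∀ᶠ M in atTop, ∀ a b : ℤ, a ≤ b → b ≤ 2 ^ M →
      |intervalSum (fun n => X M n ω) a b - intervalSum (p M) a b| ≤ δ * 2 ^ M := by
  have hP0 : 0 < P := (hp 0 0).trans_le (hP 0 0)
  have hnonneg : ∀ᵐ ω ∂μ, ∀ M n : ℕ, n < 2 ^ M → 0 ≤ X M n ω := by
    rw [ae_all_iff]; intro M
    rw [ae_all_iff]; intro n
    by_cases hn : n < 2 ^ M
    · have h := ae_nonneg_expMeasure (p M n)⁻¹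
      rw [← (hlaw M n hn).map_eq] at h
      filter_upwards [ae_of_ae_map (hlaw M n hn).aemeasurable h] with ω hω _
      exact hω
    · exact ae_of_all _ fun ω h => absurd h hn
  -- Countably many pairs `(q, i)` give one null set. For given `δ`, a single `q` and its `2 ^ q +
  -- 1` grid points suffice.
  have hgrid : ∀ᵐ ω ∂μ, ∀ q i : ℕ, ∀ᶠ M in atTop, i * 2 ^ (M - q) ≤ 2 ^ M →
      |∑ n ∈ Finset.range (i * 2 ^ (M - q)), X M n ω -
        ∑ n ∈ Finset.range (i * 2 ^ (M - q)), p M n| < ((2 : ℝ) ^ q)⁻¹ * 2 ^ M := by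
    rw [ae_all_iff]; intro q
    rw [ae_all_iff]; intro i
    exact ae_eventually_prefix_deviation_lt hp hP hlaw hindep (by positivity)
      fun M => i * 2 ^ (M - q)
  filter_upwards [hnonneg, hgrid] with ω hω0 hωg δ hδ
  -- The factor `2` counts the two ends of an interval, `1` is the grid error and `P` the error
  -- inside a cell.
  obtain ⟨q, hq⟩ : ∃ q : ℕ, 2 * (1 + P) * (1 / 2 : ℝ) ^ q < δ := by
    have h := (tendsto_pow_atTop_nhds_zero_of_lt_one (r := (1 / 2 : ℝ)) (by norm_num)
      (by norm_num)).const_mul (2 * (1 + P))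
    rw [mul_zero] at h
    exact (h.eventually_lt_const hδ).exists
  have hall : ∀ᶠ M in atTop, ∀ i ∈ Finset.range (2 ^ q + 1), i * 2 ^ (M - q) ≤ 2 ^ M →
      |∑ n ∈ Finset.range (i * 2 ^ (M - q)), X M n ω -
        ∑ n ∈ Finset.range (i * 2 ^ (M - q)), p M n| < ((2 : ℝ) ^ q)⁻¹ * 2 ^ M := by
    rw [Finset.eventually_all]
    exact fun i _ => hωg q i
  filter_upwards [hall, eventually_ge_atTop q] with M hM hqM a b hab hb
  have hN : 2 ^ q * 2 ^ (M - q) = 2 ^ M := by rw [← pow_add]; congr 1; omega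
  have hd : (((2 ^ (M - q) : ℕ)) : ℝ) = ((2 : ℝ) ^ q)⁻¹ * 2 ^ M := by
    push_cast
    rw [pow_sub₀ _ two_ne_zero hqM, mul_comm]
  have hprefix : ∀ k ≤ 2 ^ M, |∑ n ∈ Finset.range k, X M n ω - ∑ n ∈ Finset.range k, p M n| ≤
      ((2 : ℝ) ^ q)⁻¹ * 2 ^ M + P * ((2 ^ (M - q) : ℕ) : ℝ) := by
    intro k hk
    refine abs_prefix_sub_le_of_grid (q := 2 ^ q) (by positivity) ?_ (fun n => (hp M n).le) (hP M)
      ?_ (by rw [hN]; exact hk)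
    · rw [hN]; exact hω0 M
    · intro i hi
      refine (hM i (Finset.mem_range.2 (by omega)) ?_).le
      rw [← hN]
      gcongr
  refine (abs_intervalSum_sub_le hprefix hab (by exact_mod_cast hb)).trans ?_
  rw [hd]
  calc 2 * (((2 : ℝ) ^ q)⁻¹ * 2 ^ M + P * (((2 : ℝ) ^ q)⁻¹ * 2 ^ M))
      = 2 * (1 + P) * (1 / 2) ^ q * 2 ^ M := by rw [div_pow, one_pow]; ring
    _ ≤ δ * 2 ^ M := by gcongr

/-! ### Consistency of the search -/

theorem IsSmallNoise.anti {j γ τ δ δ' : ℝ} (h : IsSmallNoise j γ τ δ) (h0 : 0 ≤ δ')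
    (hle : δ' ≤ δ) : IsSmallNoise j γ τ δ' where
  j_pos := h.j_pos
  γ_pos := h.γ_pos
  nonneg := h0
  lt_remove := hle.trans_lt h.lt_remove
  le_half := by linarith [h.le_half]
  le_sq := by nlinarith [h.le_sq, h.γ_pos]
  lt_add := by linarith [h.lt_add]

theorem eventually_trueInterval_bounds {α₀ β₀ : ℝ} (hα₀ : 0 < α₀) (hαβ : α₀ < β₀) (hβ₀ : β₀ < 1) :
    ∀ᶠ M : ℕ in atTop, 0 ≤ ⌊α₀ * (2 : ℝ) ^ M⌋ ∧ ⌊α₀ * (2 : ℝ) ^ M⌋ < ⌊β₀ * (2 : ℝ) ^ M⌋ ∧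
      ⌊β₀ * (2 : ℝ) ^ M⌋ ≤ 2 ^ M ∧ (β₀ - α₀) / 2 * 2 ^ M ≤
        (⌊β₀ * (2 : ℝ) ^ M⌋ : ℝ) - ⌊α₀ * (2 : ℝ) ^ M⌋ := by
  have hlim : Tendsto (fun M : ℕ => (2 : ℝ) ^ M) atTop atTop :=
    tendsto_pow_atTop_atTop_of_one_lt one_lt_two
  have hc : 0 < β₀ - α₀ := sub_pos.2 hαβ
  -- Rounding shortens the signal by less than one bin, at most half of `(β₀ - α₀) N` once that is
  -- at least `2`.
  filter_upwards [hlim.eventually_ge_atTop (2 / (β₀ - α₀))] with M hM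
  rw [div_le_iff₀ hc] at hM
  have hN : (0 : ℝ) < 2 ^ M := by positivity
  have h1 := Int.floor_le (α₀ * (2 : ℝ) ^ M)
  have h2 := Int.sub_one_lt_floor (β₀ * (2 : ℝ) ^ M)
  have hlen : (β₀ - α₀) / 2 * 2 ^ M ≤
      (⌊β₀ * (2 : ℝ) ^ M⌋ : ℝ) - ⌊α₀ * (2 : ℝ) ^ M⌋ := by linarith
  refine ⟨Int.floor_nonneg.2 (by positivity), ?_, ?_, hlen⟩
  · have : (0 : ℝ) < (β₀ - α₀) / 2 * 2 ^ M := by positivity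
    exact_mod_cast sub_pos.1 (this.trans_le hlen)
  · have h3 := Int.floor_le (β₀ * (2 : ℝ) ^ M)
    have h4 : (⌊β₀ * (2 : ℝ) ^ M⌋ : ℝ) ≤ 2 ^ M := by nlinarith
    exact_mod_cast h4

/-- If all interval sums are uniformly close to their means, then the search is consistent. -/
theorem tendsto_IoU_of_intervalSum {α₀ β₀ γ : ℝ} (hα₀ : 0 < α₀) (hαβ : α₀ < β₀) (hβ₀ : β₀ < 1)
    (hγ : 0 < γ) {x : ℕ → ℕ → ℝ}
    (hx : ∀ δ > 0, ∀ᶠ M in atTop, ∀ a b : ℤ, a ≤ b → b ≤ 2 ^ M →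
      |intervalSum (x M) a b - intervalSum (meanPower γ (trueInterval α₀ β₀ M)) a b| ≤
        δ * 2 ^ M) :
    Tendsto (fun p : ℕ × ℕ => IoU (estimatedInterval (x p.1) p.1 p.2) (trueInterval α₀ β₀ p.1))
      (atTop ×ˢ atTop) (𝓝 1) := by
  have hc : 0 < β₀ - α₀ := sub_pos.2 hαβ
  rw [Metric.tendsto_nhds]
  intro ε hε
  obtain ⟨T, hT⟩ : ∃ T : ℕ, 16 / (β₀ - α₀) * (1 / 2 : ℝ) ^ T < ε := by
    have h := (tendsto_pow_atTop_nhds_zero_of_lt_one (r := (1 / 2 : ℝ)) (by norm_num)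
      (by norm_num)).const_mul (16 / (β₀ - α₀))
    rw [mul_zero] at h
    exact (h.eventually_lt_const hε).exists
  -- The mean over `[0, N)` exceeds `1` by at least `γ (β₀ - α₀) / 2`; half of this is reserved for
  -- the noise `δ`.
  set z : ℝ := 1 + γ * (β₀ - α₀) / 4 with hz
  have hz1 : 1 < z := by
    have : 0 < γ * (β₀ - α₀) / 4 := by positivity
    linarith
  have hj : 0 < z - 1 - Real.log z := by
    have := Real.log_lt_sub_one_of_pos (by linarith) hz1.ne'
    linarith
  obtain ⟨δ₀, hδ₀, hsmall₀⟩ := exists_isSmallNoise hj hγ (show 0 < ((2 : ℝ) ^ T)⁻¹ by positivity)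
  set δ := min δ₀ (γ * (β₀ - α₀) / 4) with hδdef
  have hδ : 0 < δ := lt_min hδ₀ (by positivity)
  have hsmall := hsmall₀.anti hδ.le (min_le_left _ _)
  have hδ' : δ ≤ γ * (β₀ - α₀) / 4 := min_le_right _ _
  -- The threshold on `M` does not depend on `t`, which yields the joint limit.
  have hM : ∀ᶠ M in atTop, ∀ t, T ≤ t →
      1 - IoU (estimatedInterval (x M) M t) (trueInterval α₀ β₀ M) < ε := by
    filter_upwards [hx δ hδ, eventually_trueInterval_bounds hα₀ hαβ hβ₀, eventually_ge_atTop T]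
      with M hdev hbounds hTM t hTt
    obtain ⟨hA, hAB, hB, hlen⟩ := hbounds
    rw [trueInterval] at hdev ⊢
    set A := ⌊α₀ * (2 : ℝ) ^ M⌋
    set B := ⌊β₀ * (2 : ℝ) ^ M⌋
    have hN : (0 : ℝ) < 2 ^ M := by positivity
    have hsig : IsNearSignal (x M) M A B γ δ := ⟨hA, hAB.le, hB, fun a b _ => hdev a b⟩
    have h0 := hsig.le_intervalObjective hz1.le (by
      have h1 : γ * ((β₀ - α₀) / 2 * 2 ^ M) ≤ γ * ((B : ℝ) - A) := by gcongr
      have h2 : δ * 2 ^ M ≤ γ * (β₀ - α₀) / 4 * 2 ^ M := by gcongr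
      rw [hz]
      linarith)
    refine (hsig.one_sub_IoU_le hsmall hAB h0 hTM hTt).trans_lt (lt_of_le_of_lt ?_ hT)
    calc 8 * 2 ^ (M - T) / ((B : ℝ) - A) ≤ 8 * 2 ^ (M - T) / ((β₀ - α₀) / 2 * 2 ^ M) := by gcongr
      _ = 16 / (β₀ - α₀) * (1 / 2) ^ T := by
        rw [pow_sub₀ _ two_ne_zero hTM, div_pow, one_pow]
        field_simp
        norm_num
  filter_upwards [hM.prod_mk (eventually_ge_atTop T)] with p hp
  rw [Real.dist_eq, abs_sub_comm, abs_of_nonneg (sub_nonneg.2 (IoU_le_one _ _))]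
  exact hp.1 p.2 hp.2

open MeasureTheory ProbabilityTheory Filter Topology in
/-- `X M n` is the power of bin `n` in the problem of size `N = 2 ^ M`. Each problem is a family of
independent exponential variables; nothing is assumed on the joint law of different problems. -/
theorem theorem1 {Ω : Type*} [MeasurableSpace Ω] (μ : Measure Ω) [IsProbabilityMeasure μ]
    (α₀ β₀ γ : ℝ) (hα₀ : 0 < α₀) (hαβ : α₀ < β₀) (hβ₀ : β₀ < 1) (hγ : 0 < γ)
    (X : ℕ → ℕ → Ω → ℝ)
    (hlaw : ∀ M n : ℕ, n < 2 ^ M →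
      HasLaw (X M n) (expMeasure (meanPower γ (trueInterval α₀ β₀ M) n)⁻¹) μ)
    (hindep : ∀ M : ℕ, iIndepFun (fun n : Fin (2 ^ M) => X M n) μ) :
    ∀ᵐ ω ∂μ, Tendsto
      (fun p : ℕ × ℕ =>
        IoU (estimatedInterval (fun n => X p.1 n ω) p.1 p.2) (trueInterval α₀ β₀ p.1))
      (atTop ×ˢ atTop) (𝓝 1) := by
  have hpos (M n : ℕ) : 0 < meanPower γ (trueInterval α₀ β₀ M) n :=
    zero_lt_one.trans_le (one_le_meanPower hγ.le _ n)
  have hdev := ae_eventually_abs_intervalSum_sub_le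
    (p := fun M => meanPower γ (trueInterval α₀ β₀ M)) hpos
    (fun M => meanPower_le hγ.le (trueInterval α₀ β₀ M)) hlaw hindep
  filter_upwards [hdev] with ω hω
  exact tendsto_IoU_of_intervalSum (x := fun M n => X M n ω) hα₀ hαβ hβ₀ hγ hω
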